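/- Let $n\ge 0$ and let $(M^{4n+3},\phi_\alpha,\xi_\alpha,\eta_\alpha,g)$, $\alpha\in\{1,2,3\}$, be a $3$-cosymplectic manifold. That is, $M$ is a smooth $(4n+3)$-dimensional manifold with a Riemannian metric $g$, fields of endomorphisms $\phi_\alpha$, vector fields $\xi_\alpha$ and $1$-forms $\eta_\alpha$ (all smooth) such that, for all $\alpha,\beta$, $\phi_\alpha^2=-I+\eta_\alpha\otimes\xi_\alpha$, $\eta_\alpha(\xi_\alpha)=1$, $$\phi_\alpha\phi_\beta-\eta_\beta\otimes\xi_\alpha=\sum_{\gamma}\epsilon_{\alpha\beta\gamma}\phi_\gamma-\delta_{\alpha\beta}I,\quad \phi_\alpha\xi_\beta=\sum_\gamma\epsilon_{\alpha\beta\gamma}\xi_\gamma,\quad \eta_\alpha\circ\phi_\beta=\sum_\gamma\epsilon_{\alpha\beta\gamma}\eta_\gamma,$$ $g(\phi_\alpha E,\phi_\alpha F)=g(E,F)-\eta_\alpha(E)\eta_\alpha(F)$, the forms $\eta_\alpha$ and $\Phi_\alpha(E,F):=g(E,\phi_\alpha F)$ are closed, and $[\phi_\alpha,\phi_\alpha]+2d\eta_\alpha\otimes\xi_\alpha=0$,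 where $[\phi_\alpha,\phi_\alpha]$ is the Nijenhuis tensor. We use the conventions $(\theta\wedge\theta')(E,F)=\frac12(\theta(E)\theta'(F)-\theta(F)\theta'(E))$ and $2\,d\theta(E,F)=E(\theta(F))-F(\theta(E))-\theta([E,F])$ for $1$-forms $\theta,\theta'$. Suppose that each point of $M$ has a neighbourhood with smooth local coordinates $\{x_1,\dots,x_n,y_1,\dots,y_n,u_1,\dots,u_n,v_1,\dots,v_n,z_1,z_2,z_3\}$ in which, for some sign $\sigma\in\{1,-1\}$ (which may depend on the coordinate system), $$\Phi_1=2\sigma\sum_{i=1}^{n}(dx_i\wedge dy_i+du_i\wedge dv_i)-2\,dz_2\wedge dz_3,$$ $$\Phi_2=2\sigma\sum_{i=1}^{n}(dx_i\wedge du_i-dy_i\wedge dv_i)+2\,dz_1\wedge dz_3,$$ $$\Phi_3=2\sigma\sum_{i=1}^{n}(dx_i\wedge dv_i+dy_i\wedge du_i)-2\,dz_1\wedge dz_2.$$ Then $M$ is flat, i.e. the Riemann curvature tensor of $g$ vanishes identically. -/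

import Mathlib

open Bundle
open scoped Manifold ContDiff

noncomputable section

namespace ThreeCosymplectic

section Manifold

variable {d : ℕ} {M : Type*} [TopologicalSpace M]
  [ChartedSpace (EuclideanSpace ℝ (Fin d)) M] [IsManifold (𝓡 d) ∞ M]

/-! ### Fields and the exterior derivative -/

/-- The (possibly rough) vector field `X` on `M` is smooth at (hence, to every finite order, near)
the point `p`. -/
def SmoothFieldAt (X : Π p : M, TangentSpace (𝓡 d) p) (p : M) : Prop :=
  ContMDiffAt (𝓡 d) (𝓡 d).tangent ∞ (fun q => (⟨q, X q⟩ : TangentBundle (𝓡 d) M)) p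

/-- The derivative at `p` of the function `f` in the direction of the vector field `X`. -/
def dirDeriv (X : Π p : M, TangentSpace (𝓡 d) p) (f : M → ℝ) (p : M) : ℝ :=
  mvfderiv (𝓡 d) f p (X p)

/-- The exterior derivative of a 1-form, evaluated on two vector fields:
`dθ(X,Y) = ½ (X(θ Y) - Y(θ X) - θ[X,Y])`. -/
def extDerivOneForm (θ : Π p : M, TangentSpace (𝓡 d) p →L[ℝ] ℝ)
    (X Y : Π p : M, TangentSpace (𝓡 d) p) (p : M) : ℝ :=
  (1 / 2) * (dirDeriv X (fun q => θ q (Y q)) p - dirDeriv Y (fun q => θ q (X q)) p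
    - θ p (VectorField.mlieBracket (𝓡 d) X Y p))

/-- The exterior derivative of a 2-form, evaluated on three vector fields:
`dΩ(X,Y,Z) = ⅓ (X Ω(Y,Z) + Y Ω(Z,X) + Z Ω(X,Y) - Ω([X,Y],Z) - Ω([Y,Z],X) - Ω([Z,X],Y))`. -/
def extDerivTwoForm (Ω : Π p : M, TangentSpace (𝓡 d) p → TangentSpace (𝓡 d) p → ℝ)
    (X Y Z : Π p : M, TangentSpace (𝓡 d) p) (p : M) : ℝ :=
  (1 / 3) * (dirDeriv X (fun q => Ω q (Y q) (Z q)) p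
    + dirDeriv Y (fun q => Ω q (Z q) (X q)) p
    + dirDeriv Z (fun q => Ω q (X q) (Y q)) p
    - Ω p (VectorField.mlieBracket (𝓡 d) X Y p) (Z p)
    - Ω p (VectorField.mlieBracket (𝓡 d) Y Z p) (X p)
    - Ω p (VectorField.mlieBracket (𝓡 d) Z X p) (Y p))

/-- The 1-form `θ` is closed. -/
def IsClosedOneForm (θ : Π p : M, TangentSpace (𝓡 d) p →L[ℝ] ℝ) : Prop :=
  ∀ (p : M) (X Y : Π p : M, TangentSpace (𝓡 d) p),
    SmoothFieldAt X p → SmoothFieldAt Y p → extDerivOneForm θ X Y p = 0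

/-- The 2-form `Ω` is closed. -/
def IsClosedTwoForm (Ω : Π p : M, TangentSpace (𝓡 d) p → TangentSpace (𝓡 d) p → ℝ) : Prop :=
  ∀ (p : M) (X Y Z : Π p : M, TangentSpace (𝓡 d) p),
    SmoothFieldAt X p → SmoothFieldAt Y p → SmoothFieldAt Z p → extDerivTwoForm Ω X Y Z p = 0

/-- The Nijenhuis tensor of a field of endomorphisms, evaluated on two vector fields:
`[φ,φ](X,Y) = φ²[X,Y] + [φX,φY] - φ[φX,Y] - φ[X,φY]`. -/
def nijenhuis (φ : Π p : M, TangentSpace (𝓡 d) p →L[ℝ] TangentSpace (𝓡 d) p)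
    (X Y : Π p : M, TangentSpace (𝓡 d) p) (p : M) : TangentSpace (𝓡 d) p :=
  φ p (φ p (VectorField.mlieBracket (𝓡 d) X Y p))
    + VectorField.mlieBracket (𝓡 d) (fun q => φ q (X q)) (fun q => φ q (Y q)) p
    - φ p (VectorField.mlieBracket (𝓡 d) (fun q => φ q (X q)) Y p)
    - φ p (VectorField.mlieBracket (𝓡 d) X (fun q => φ q (Y q)) p)

/-- The almost contact structure `(φ, ξ, η)` is normal: `[φ,φ] + 2 dη ⊗ ξ = 0`. -/
def IsNormal (φ : Π p : M, TangentSpace (𝓡 d) p →L[ℝ] TangentSpace (𝓡 d) p)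
    (ξ : Π p : M, TangentSpace (𝓡 d) p) (η : Π p : M, TangentSpace (𝓡 d) p →L[ℝ] ℝ) : Prop :=
  ∀ (p : M) (X Y : Π p : M, TangentSpace (𝓡 d) p), SmoothFieldAt X p → SmoothFieldAt Y p →
    nijenhuis φ X Y p + (2 * extDerivOneForm η X Y p) • ξ p = 0

/-! ### Riemannian curvature in local coordinates -/

variable (d M) in
/-- Smooth Riemannian metrics on `M`. -/
abbrev RiemannianMetric : Type _ :=
  ContMDiffRiemannianMetric (𝓡 d) ∞ (EuclideanSpace ℝ (Fin d))
    (fun p : M => TangentSpace (𝓡 d) p)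

/-- The coordinate vector `∂/∂x_i` of the chart `e`, at the point with coordinates `y`. -/
def coordVec (e : OpenPartialHomeomorph M (EuclideanSpace ℝ (Fin d))) (i : Fin d)
    (y : EuclideanSpace ℝ (Fin d)) : TangentSpace (𝓡 d) (e.symm y) :=
  mfderiv (𝓡 d) (𝓡 d) e.symm y (EuclideanSpace.single i (1 : ℝ) : EuclideanSpace ℝ (Fin d))

/-- The matrix `(g_ij)` of the metric in the chart `e`, as a function of the coordinates. -/
def metricMatrix (g : RiemannianMetric d M)
    (e : OpenPartialHomeomorph M (EuclideanSpace ℝ (Fin d)))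
    (y : EuclideanSpace ℝ (Fin d)) : Matrix (Fin d) (Fin d) ℝ :=
  Matrix.of fun i j => g.inner (e.symm y) (coordVec e i y) (coordVec e j y)

/-- The `i`-th partial derivative of a function of `d` real variables. -/
def partialDeriv (i : Fin d) (f : EuclideanSpace ℝ (Fin d) → ℝ)
    (y : EuclideanSpace ℝ (Fin d)) : ℝ :=
  fderiv ℝ f y (EuclideanSpace.single i (1 : ℝ))

/-- The Christoffel symbols of the Levi-Civita connection in the chart `e`:
`Γ^k_ij = ½ ∑_l g^kl (∂_i g_jl + ∂_j g_il - ∂_l g_ij)`. -/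
def christoffel (g : RiemannianMetric d M)
    (e : OpenPartialHomeomorph M (EuclideanSpace ℝ (Fin d))) (k i j : Fin d)
    (y : EuclideanSpace ℝ (Fin d)) : ℝ :=
  (1 / 2) * ∑ l, (metricMatrix g e y)⁻¹ k l *
    (partialDeriv i (fun w => metricMatrix g e w j l) y
      + partialDeriv j (fun w => metricMatrix g e w i l) y
      - partialDeriv l (fun w => metricMatrix g e w i j) y)

/-- The components of the Riemann curvature tensor in the chart `e`,
`R(∂_i, ∂_j) ∂_k = ∑_l R^l_kij ∂_l` with
`R^l_kij = ∂_i Γ^l_jk - ∂_j Γ^l_ik + ∑_m (Γ^l_im Γ^m_jk - Γ^l_jm Γ^m_ik)`. -/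
def riemannTensor (g : RiemannianMetric d M)
    (e : OpenPartialHomeomorph M (EuclideanSpace ℝ (Fin d))) (l k i j : Fin d)
    (y : EuclideanSpace ℝ (Fin d)) : ℝ :=
  partialDeriv i (christoffel g e l j k) y - partialDeriv j (christoffel g e l i k) y
    + ∑ m, (christoffel g e l i m y * christoffel g e m j k y
      - christoffel g e l j m y * christoffel g e m i k y)

/-- The metric is flat: its Riemann curvature tensor vanishes identically (in every smooth chart). -/
def IsFlat (g : RiemannianMetric d M) : Prop :=
  ∀ e ∈ IsManifold.maximalAtlas (𝓡 d) ∞ M, ∀ p ∈ e.source, ∀ l k i j : Fin d,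
    riemannTensor g e l k i j (e p) = 0

/-! ### Coordinate differentials -/

/-- The differential `dx_j`, at `p`, of the `j`-th coordinate function of the chart `e`. -/
def coordDiff (e : OpenPartialHomeomorph M (EuclideanSpace ℝ (Fin d))) (j : Fin d) (p : M) :
    TangentSpace (𝓡 d) p →L[ℝ] ℝ :=
  mvfderiv (𝓡 d) (fun q => e q j) p

/-- `(dx_j ∧ dx_k)(X, Y)` for the chart `e`, with the normalisation
`(α ∧ β)(X, Y) = ½ (α(X) β(Y) - α(Y) β(X))`. -/
def coordWedge (e : OpenPartialHomeomorph M (EuclideanSpace ℝ (Fin d))) (j k : Fin d) (p : M)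
    (X Y : TangentSpace (𝓡 d) p) : ℝ :=
  (1 / 2) * (coordDiff e j p X * coordDiff e k p Y - coordDiff e j p Y * coordDiff e k p X)

end Manifold

/-! ### 3-cosymplectic manifolds -/

/-- The totally antisymmetric symbol on three indices, with `eps 0 1 2 = 1`. -/
def eps (α β γ : Fin 3) : ℝ :=
  Matrix.det (Matrix.of ![Pi.single α (1 : ℝ), Pi.single β 1, Pi.single γ 1])

/-- An almost contact metric 3-structure on the `(4n+3)`-dimensional smooth manifold `M`. The indices
1, 2, 3 are represented by `0, 1, 2 : Fin 3`. -/
structure AlmostContactMetricThreeStructure (n : ℕ) (M : Type*) [TopologicalSpace M]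
    [ChartedSpace (EuclideanSpace ℝ (Fin (4 * n + 3))) M]
    [IsManifold (𝓡 (4 * n + 3)) ∞ M] where
  /-- the Riemannian metric -/
  g : RiemannianMetric (4 * n + 3) M
  /-- the fields of endomorphisms -/
  φ : Fin 3 → Π p : M, TangentSpace (𝓡 (4 * n + 3)) p →L[ℝ] TangentSpace (𝓡 (4 * n + 3)) p
  /-- the Reeb vector fields -/
  ξ : Fin 3 → Π p : M, TangentSpace (𝓡 (4 * n + 3)) p
  /-- the 1-forms -/
  η : Fin 3 → Π p : M, TangentSpace (𝓡 (4 * n + 3)) p →L[ℝ] ℝ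
  contMDiff_φ : ∀ α, ContMDiff (𝓡 (4 * n + 3))
    ((𝓡 (4 * n + 3)).prod 𝓘(ℝ, EuclideanSpace ℝ (Fin (4 * n + 3)) →L[ℝ]
      EuclideanSpace ℝ (Fin (4 * n + 3)))) ∞
    (fun p => TotalSpace.mk'
      (EuclideanSpace ℝ (Fin (4 * n + 3)) →L[ℝ] EuclideanSpace ℝ (Fin (4 * n + 3)))
      (E := fun p : M =>
        TangentSpace (𝓡 (4 * n + 3)) p →L[ℝ] TangentSpace (𝓡 (4 * n + 3)) p) p (φ α p))
  contMDiff_ξ : ∀ α, ContMDiff (𝓡 (4 * n + 3)) (𝓡 (4 * n + 3)).tangent ∞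
    (fun p => (⟨p, ξ α p⟩ : TangentBundle (𝓡 (4 * n + 3)) M))
  contMDiff_η : ∀ α, ContMDiff (𝓡 (4 * n + 3))
    ((𝓡 (4 * n + 3)).prod 𝓘(ℝ, EuclideanSpace ℝ (Fin (4 * n + 3)) →L[ℝ] ℝ)) ∞
    (fun p => TotalSpace.mk' (EuclideanSpace ℝ (Fin (4 * n + 3)) →L[ℝ] ℝ)
      (E := fun p : M => TangentSpace (𝓡 (4 * n + 3)) p →L[ℝ] ℝ) p (η α p))
  /-- `φ_α² = -I + η_α ⊗ ξ_α` -/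
  φ_sq : ∀ α p X, φ α p (φ α p X) = -X + η α p X • ξ α p
  /-- `η_α(ξ_α) = 1` -/
  η_ξ : ∀ α p, η α p (ξ α p) = 1
  /-- `φ_α φ_β - η_β ⊗ ξ_α = ∑_γ ε_αβγ φ_γ - δ_αβ I` -/
  φ_φ : ∀ α β p X, φ α p (φ β p X) - η β p X • ξ α p
    = ∑ γ, eps α β γ • φ γ p X - (if α = β then (1 : ℝ) else 0) • X
  /-- `φ_α ξ_β = ∑_γ ε_αβγ ξ_γ` -/
  φ_ξ : ∀ α β p, φ α p (ξ β p) = ∑ γ, eps α β γ • ξ γ p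
  /-- `η_α ∘ φ_β = ∑_γ ε_αβγ η_γ` -/
  η_φ : ∀ α β p X, η α p (φ β p X) = ∑ γ, eps α β γ * η γ p X
  /-- `g(φ_α X, φ_α Y) = g(X, Y) - η_α(X) η_α(Y)` -/
  g_φ : ∀ α p X Y, g.inner p (φ α p X) (φ α p Y) = g.inner p X Y - η α p X * η α p Y

namespace AlmostContactMetricThreeStructure

variable {n : ℕ} {M : Type*} [TopologicalSpace M]
  [ChartedSpace (EuclideanSpace ℝ (Fin (4 * n + 3))) M] [IsManifold (𝓡 (4 * n + 3)) ∞ M]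

/-- The fundamental 2-form `Φ_α(X, Y) = g(X, φ_α Y)`. -/
def Φ (S : AlmostContactMetricThreeStructure n M) (α : Fin 3) (p : M)
    (X Y : TangentSpace (𝓡 (4 * n + 3)) p) : ℝ :=
  S.g.inner p X (S.φ α p Y)

/-- The structure is 3-cosymplectic: all `η_α` and `Φ_α` are closed (the structure is almost
3-cosymplectic) and all three almost contact structures are normal. -/
structure IsThreeCosymplectic (S : AlmostContactMetricThreeStructure n M) : Prop where
  closed_η : ∀ α, IsClosedOneForm (S.η α)
  closed_Φ : ∀ α, IsClosedTwoForm (S.Φ α)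
  normal : ∀ α, IsNormal (S.φ α) (S.ξ α) (S.η α)

end AlmostContactMetricThreeStructure

/-! The coordinates of a Darboux chart are numbered in the order
`x_1, …, x_n, y_1, …, y_n, u_1, …, u_n, v_1, …, v_n, z_1, z_2, z_3`. -/

/-- index of `x_i` -/
def ix {n : ℕ} (i : Fin n) : Fin (4 * n + 3) := ⟨i, by omega⟩
/-- index of `y_i` -/
def iy {n : ℕ} (i : Fin n) : Fin (4 * n + 3) := ⟨n + i, by omega⟩
/-- index of `u_i` -/
def iu {n : ℕ} (i : Fin n) : Fin (4 * n + 3) := ⟨2 * n + i, by omega⟩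
/-- index of `v_i` -/
def iv {n : ℕ} (i : Fin n) : Fin (4 * n + 3) := ⟨3 * n + i, by omega⟩
/-- index of `z_a` -/
def iz {n : ℕ} (a : Fin 3) : Fin (4 * n + 3) := ⟨4 * n + a, by omega⟩

/-- On the domain of the chart `e`, the fundamental 2-forms have the Darboux normal form with sign
`σ` in the horizontal coordinates:
`Φ₁ = 2σ ∑ (dx_i ∧ dy_i + du_i ∧ dv_i) - 2 dz₂ ∧ dz₃`,
`Φ₂ = 2σ ∑ (dx_i ∧ du_i - dy_i ∧ dv_i) + 2 dz₁ ∧ dz₃`,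
`Φ₃ = 2σ ∑ (dx_i ∧ dv_i + dy_i ∧ du_i) - 2 dz₁ ∧ dz₂`. -/
def IsDarbouxChart {n : ℕ} {M : Type*} [TopologicalSpace M]
    [ChartedSpace (EuclideanSpace ℝ (Fin (4 * n + 3))) M] [IsManifold (𝓡 (4 * n + 3)) ∞ M]
    (S : AlmostContactMetricThreeStructure n M) (σ : ℝ)
    (e : OpenPartialHomeomorph M (EuclideanSpace ℝ (Fin (4 * n + 3)))) : Prop :=
  ∀ p ∈ e.source, ∀ X Y : TangentSpace (𝓡 (4 * n + 3)) p,
    S.Φ 0 p X Y = 2 * σ * ∑ i : Fin n,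
        (coordWedge e (ix i) (iy i) p X Y + coordWedge e (iu i) (iv i) p X Y)
        - 2 * coordWedge e (iz 1) (iz 2) p X Y ∧
    S.Φ 1 p X Y = 2 * σ * ∑ i : Fin n,
        (coordWedge e (ix i) (iu i) p X Y - coordWedge e (iy i) (iv i) p X Y)
        + 2 * coordWedge e (iz 0) (iz 2) p X Y ∧
    S.Φ 2 p X Y = 2 * σ * ∑ i : Fin n,
        (coordWedge e (ix i) (iv i) p X Y + coordWedge e (iy i) (iu i) p X Y)
        - 2 * coordWedge e (iz 0) (iz 1) p X Y

end ThreeCosymplectic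

end

/-! The forms `Φ α` at a point determine the inner product there (`g_eq_of_Φ_eq`). The kernel of `Φ
α` is the line of `ξ α`. Contracting the forms with the Reeb vectors recovers the `η α`, up to a
sign common to all three `ξ α` and `η α`, and this sign cancels in `g`. On horizontal vectors `φ 2`
is recovered by comparing `Φ 1` with `Φ 0`, and then `g` is `-Φ 2 (·, φ 2 ·)`.

In a Darboux chart the forms have constant coefficients, hence so does `g`
(`IsDarbouxChart.metric_eq`). In an arbitrary chart `g` is therefore the pull-back of a constant
inner product `B` under the transition map `F`. For such a metric `∑ k, Γ^k_ij ∂_k F = ∂_i ∂_j F`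
(`sum_christoffel_smul`). Differentiating once more expresses the curvature as the
antisymmetrisation of third derivatives of `F`, which is zero (`riemannTensor_eq_zero`). -/

namespace ThreeCosymplectic

/-! ### Curvature of the pull-back of a constant inner product. -/

section Local
variable {d : ℕ}

/-- The partial derivative of a vector-valued function. -/
noncomputable def vecPartialDeriv (i : Fin d)
    (u : EuclideanSpace ℝ (Fin d) → EuclideanSpace ℝ (Fin d)) (y : EuclideanSpace ℝ (Fin d)) :
    EuclideanSpace ℝ (Fin d) :=
  fderiv ℝ u y (EuclideanSpace.single i 1)

theorem contDiffAt_vecPartialDeriv (i : Fin d)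
    {u : EuclideanSpace ℝ (Fin d) → EuclideanSpace ℝ (Fin d)} {y : EuclideanSpace ℝ (Fin d)}
    (hu : ContDiffAt ℝ ∞ u y) :
    ContDiffAt ℝ ∞ (vecPartialDeriv i u) y :=
  (hu.fderiv_right (m := ∞) (by simp)).clm_apply contDiffAt_const

theorem vecPartialDeriv_comm (i j : Fin d)
    {u : EuclideanSpace ℝ (Fin d) → EuclideanSpace ℝ (Fin d)} {y : EuclideanSpace ℝ (Fin d)}
    (hu : ContDiffAt ℝ ∞ u y) :
    vecPartialDeriv i (vecPartialDeriv j u) y = vecPartialDeriv j (vecPartialDeriv i u) y := by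
  have hd : DifferentiableAt ℝ (fderiv ℝ u) y :=
    (hu.fderiv_right (m := ∞) (by simp)).differentiableAt (by simp)
  have key : ∀ i j, vecPartialDeriv i (vecPartialDeriv j u) y =
      fderiv ℝ (fderiv ℝ u) y (EuclideanSpace.single i 1) (EuclideanSpace.single j 1) := by
    intro i j
    have h := (hd.hasFDerivAt.clm_apply
      (hasFDerivAt_const (EuclideanSpace.single j (1 : ℝ)) y)).fderiv
    unfold vecPartialDeriv
    rw [h]
    simp
  rw [key, key]
  exact hu.isSymmSndFDerivAt
    (by rw [minSmoothness_of_isRCLikeNormedField]; exact WithTop.coe_le_coe.mpr le_top) _ _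

theorem partialDeriv_bilin (B : EuclideanSpace ℝ (Fin d) →L[ℝ] EuclideanSpace ℝ (Fin d) →L[ℝ] ℝ)
    (i : Fin d) {u v : EuclideanSpace ℝ (Fin d) → EuclideanSpace ℝ (Fin d)}
    {y : EuclideanSpace ℝ (Fin d)}
    (hu : DifferentiableAt ℝ u y) (hv : DifferentiableAt ℝ v y) :
    partialDeriv i (fun w => B (u w) (v w)) y =
      B (vecPartialDeriv i u y) (v y) + B (u y) (vecPartialDeriv i v y) := by
  have h : HasFDerivAt (fun w => B (u w) (v w)) _ y :=
    ((B.hasFDerivAt.comp y hu.hasFDerivAt).clm_apply hv.hasFDerivAt)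
  unfold partialDeriv vecPartialDeriv
  rw [h.fderiv]
  simp [add_comm]

theorem vecPartialDeriv_sum_smul (m : Fin d) {c : Fin d → EuclideanSpace ℝ (Fin d) → ℝ}
    {u : Fin d → EuclideanSpace ℝ (Fin d) → EuclideanSpace ℝ (Fin d)} {y : EuclideanSpace ℝ (Fin d)}
    (hc : ∀ k, DifferentiableAt ℝ (c k) y) (hu : ∀ k, DifferentiableAt ℝ (u k) y) :
    vecPartialDeriv m (fun w => ∑ k, c k w • u k w) y =
      ∑ k, (partialDeriv m (c k) y • u k y + c k y • vecPartialDeriv m (u k) y) := by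
  have h : HasFDerivAt (fun w => ∑ k, c k w • u k w) _ y :=
    HasFDerivAt.fun_sum fun k _ => (hc k).hasFDerivAt.smul (hu k).hasFDerivAt
  unfold partialDeriv vecPartialDeriv
  rw [h.fderiv]
  simp [add_comm]

theorem fderiv_apply_eq_sum (F : EuclideanSpace ℝ (Fin d) → EuclideanSpace ℝ (Fin d))
    (y c : EuclideanSpace ℝ (Fin d)) :
    fderiv ℝ F y c = ∑ k, c k • vecPartialDeriv k F y := by
  have : c = ∑ k, c k • EuclideanSpace.single k (1 : ℝ) := by
    ext j
    simp [Finset.sum_apply, Pi.single_apply]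
  conv_lhs => rw [this]
  simp [vecPartialDeriv]

/-- The vectors `∂_k F` are the columns of an invertible differential, hence independent; this lets
coefficients be compared. -/
theorem eq_zero_of_sum_smul_vecPartialDeriv
    {F : EuclideanSpace ℝ (Fin d) → EuclideanSpace ℝ (Fin d)} {y : EuclideanSpace ℝ (Fin d)}
    (hinv : (fderiv ℝ F y).IsInvertible) {c : Fin d → ℝ}
    (h : ∑ k, c k • vecPartialDeriv k F y = 0) (k : Fin d) : c k = 0 := by
  have h1 : fderiv ℝ F y (WithLp.toLp 2 c) = 0 := by
    rw [fderiv_apply_eq_sum]; exact h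
  have h2 := hinv.injective (h1.trans (map_zero _).symm)
  simpa using congrArg (fun v : EuclideanSpace ℝ (Fin d) => v k) h2

variable {M : Type*} [TopologicalSpace M] [ChartedSpace (EuclideanSpace ℝ (Fin d)) M]
  [IsManifold (𝓡 d) ∞ M]

/-- In the coordinates of the chart `e`, the metric `g` is the pull-back of a constant inner product
under a local diffeomorphism `F`. -/
structure IsPullbackOfConstant (g : RiemannianMetric d M)
    (e : OpenPartialHomeomorph M (EuclideanSpace ℝ (Fin d)))
    (B : EuclideanSpace ℝ (Fin d) →L[ℝ] EuclideanSpace ℝ (Fin d) →L[ℝ] ℝ)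
    (F : EuclideanSpace ℝ (Fin d) → EuclideanSpace ℝ (Fin d))
    (U : Set (EuclideanSpace ℝ (Fin d))) : Prop where
  isOpen : IsOpen U
  symm : ∀ v w, B v w = B w v
  definite : ∀ v, B v v = 0 → v = 0
  smooth : ∀ y ∈ U, ContDiffAt ℝ ∞ F y
  invertible : ∀ y ∈ U, (fderiv ℝ F y).IsInvertible
  metric : ∀ y ∈ U, ∀ i j, metricMatrix g e y i j =
    B (vecPartialDeriv i F y) (vecPartialDeriv j F y)

namespace IsPullbackOfConstant

variable {g : RiemannianMetric d M} {e : OpenPartialHomeomorph M (EuclideanSpace ℝ (Fin d))}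
  {B : EuclideanSpace ℝ (Fin d) →L[ℝ] EuclideanSpace ℝ (Fin d) →L[ℝ] ℝ}
  {F : EuclideanSpace ℝ (Fin d) → EuclideanSpace ℝ (Fin d)} {U : Set (EuclideanSpace ℝ (Fin d))}
  {y : EuclideanSpace ℝ (Fin d)}

theorem isUnit_det (h : IsPullbackOfConstant g e B F U) (hy : y ∈ U) :
    IsUnit (metricMatrix g e y).det := by
  rw [isUnit_iff_ne_zero]
  intro h0
  obtain ⟨c, hc, hc0⟩ := Matrix.exists_mulVec_eq_zero_iff.mpr h0
  apply hc
  -- A kernel vector `c` of the Gram matrix makes `∑ c_j ∂_j F` orthogonal to every `∂_i F`, hence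
  -- to itself.
  have hB : B (∑ j, c j • vecPartialDeriv j F y) (∑ j, c j • vecPartialDeriv j F y) = 0 := by
    have h1 : ∀ i, B (vecPartialDeriv i F y) (∑ j, c j • vecPartialDeriv j F y) = 0 := by
      intro i
      have := congrFun hc0 i
      rw [Matrix.mulVec, dotProduct] at this
      simpa [h.metric y hy, mul_comm] using this
    rw [h.symm, map_sum]
    simp only [map_smul]
    apply Finset.sum_eq_zero
    intro i _
    rw [h.symm, h1, smul_zero]
  funext k
  exact eq_zero_of_sum_smul_vecPartialDeriv (h.invertible y hy) (h.definite _ hB) k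

theorem partialDeriv_metric (h : IsPullbackOfConstant g e B F U) (hy : y ∈ U) (m i j : Fin d) :
    partialDeriv m (fun w => metricMatrix g e w i j) y =
      B (vecPartialDeriv m (vecPartialDeriv i F) y) (vecPartialDeriv j F y) +
      B (vecPartialDeriv i F y) (vecPartialDeriv m (vecPartialDeriv j F) y) := by
  have hev : (fun w => metricMatrix g e w i j) =ᶠ[nhds y]
      fun w => B (vecPartialDeriv i F w) (vecPartialDeriv j F w) := by
    filter_upwards [h.isOpen.mem_nhds hy] with w hw using h.metric w hw i j
  rw [partialDeriv, hev.fderiv_eq]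
  exact partialDeriv_bilin B m
    ((contDiffAt_vecPartialDeriv i (h.smooth y hy)).differentiableAt (by simp))
    ((contDiffAt_vecPartialDeriv j (h.smooth y hy)).differentiableAt (by simp))

/-- The Christoffel symbols are the coordinates of `∂_i ∂_j F` in the basis `∂_k F`; applying `g⁻¹`
to the products `B (∂_l F) (∂_i ∂_j F)` extracts them. -/
theorem christoffel_eq (h : IsPullbackOfConstant g e B F U) (hy : y ∈ U) (k i j : Fin d) :
    christoffel g e k i j y =
      (fderiv ℝ F y).inverse (vecPartialDeriv i (vecPartialDeriv j F) y) k := by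
  have hs := h.smooth y hy
  set c : EuclideanSpace ℝ (Fin d) := (fderiv ℝ F y).inverse
      (vecPartialDeriv i (vecPartialDeriv j F) y) with hc
  have hHc : vecPartialDeriv i (vecPartialDeriv j F) y = ∑ k, c k • vecPartialDeriv k F y := by
    rw [← fderiv_apply_eq_sum, hc, (h.invertible y hy).self_apply_inverse]
  -- Of the six terms given by the product rule, four cancel by symmetry of `B` and of second
  -- derivatives; the other two both equal `B (∂_l F) (∂_i ∂_j F)`.
  have hl : ∀ l, partialDeriv i (fun w => metricMatrix g e w j l) y
      + partialDeriv j (fun w => metricMatrix g e w i l) y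
      - partialDeriv l (fun w => metricMatrix g e w i j) y
      = 2 * (metricMatrix g e y).mulVec c l := by
    intro l
    have hmv : (metricMatrix g e y).mulVec c l =
        B (vecPartialDeriv l F y) (vecPartialDeriv i (vecPartialDeriv j F) y) := by
      rw [hHc, Matrix.mulVec, dotProduct]
      simp [h.metric y hy, mul_comm]
    rw [hmv, h.partialDeriv_metric hy, h.partialDeriv_metric hy, h.partialDeriv_metric hy,
      vecPartialDeriv_comm j i hs, vecPartialDeriv_comm l i hs, vecPartialDeriv_comm l j hs,
      h.symm (vecPartialDeriv i (vecPartialDeriv l F) y),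
      h.symm (vecPartialDeriv i (vecPartialDeriv j F) y)]
    ring
  have hinv : (metricMatrix g e y)⁻¹.mulVec ((metricMatrix g e y).mulVec c) = c := by
    rw [Matrix.mulVec_mulVec, Matrix.nonsing_inv_mul _ (h.isUnit_det hy), Matrix.one_mulVec]
  have hk := congrFun hinv k
  rw [Matrix.mulVec, dotProduct] at hk
  unfold christoffel
  simp only [hl]
  rw [← hk, Finset.mul_sum]
  refine Finset.sum_congr rfl fun l _ => ?_
  ring

theorem sum_christoffel_smul (h : IsPullbackOfConstant g e B F U) (hy : y ∈ U) (i j : Fin d) :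
    ∑ k, christoffel g e k i j y • vecPartialDeriv k F y =
      vecPartialDeriv i (vecPartialDeriv j F) y := by
  simp only [h.christoffel_eq hy]
  rw [← fderiv_apply_eq_sum, (h.invertible y hy).self_apply_inverse]

theorem differentiableAt_christoffel (h : IsPullbackOfConstant g e B F U) (hy : y ∈ U)
    (k i j : Fin d) : DifferentiableAt ℝ (christoffel g e k i j) y := by
  have hev : christoffel g e k i j =ᶠ[nhds y] fun w =>
      (fderiv ℝ F w).inverse (vecPartialDeriv i (vecPartialDeriv j F) w) k := by
    filter_upwards [h.isOpen.mem_nhds hy] with w hw using h.christoffel_eq hw k i j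
  refine DifferentiableAt.congr_of_eventuallyEq ?_ hev
  have hs := h.smooth y hy
  have h1 : DifferentiableAt ℝ (fun w => (fderiv ℝ F w).inverse) y := by
    -- Inversion of operators is smooth at an invertible one.
    obtain ⟨A, hA⟩ := h.invertible y hy
    have h2 := contDiffAt_map_inverse (𝕜 := ℝ) (n := 1) A
    rw [hA] at h2
    exact (h2.differentiableAt (by simp)).comp y
      ((hs.fderiv_right (m := ∞) (by simp)).differentiableAt (by simp))
  have h2 : DifferentiableAt ℝ (vecPartialDeriv i (vecPartialDeriv j F)) y :=
    (contDiffAt_vecPartialDeriv i (contDiffAt_vecPartialDeriv j hs)).differentiableAt (by simp)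
  exact (EuclideanSpace.proj (𝕜 := ℝ) k).differentiableAt.comp y (h1.clm_apply h2)

/-- Differentiate `sum_christoffel_smul` and re-expand the second derivatives in the basis `∂_l F`.
The coefficient is the half of the curvature that is not yet antisymmetrised. -/
theorem sum_smul_eq_third_deriv (h : IsPullbackOfConstant g e B F U) (hy : y ∈ U)
    (m i j : Fin d) :
    ∑ l, (partialDeriv m (christoffel g e l i j) y
        + ∑ k, christoffel g e l m k y * christoffel g e k i j y) • vecPartialDeriv l F y =
      vecPartialDeriv m (vecPartialDeriv i (vecPartialDeriv j F)) y := by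
  have hev : (vecPartialDeriv i (vecPartialDeriv j F)) =ᶠ[nhds y] fun w =>
      ∑ k, christoffel g e k i j w • vecPartialDeriv k F w := by
    filter_upwards [h.isOpen.mem_nhds hy] with w hw using (h.sum_christoffel_smul hw i j).symm
  have hd := vecPartialDeriv_sum_smul m (fun k => h.differentiableAt_christoffel hy k i j)
    (fun k => (contDiffAt_vecPartialDeriv k (h.smooth y hy)).differentiableAt (by simp))
  have h0 : vecPartialDeriv m (vecPartialDeriv i (vecPartialDeriv j F)) y =
      vecPartialDeriv m (fun w => ∑ k, christoffel g e k i j w • vecPartialDeriv k F w) y := by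
    rw [vecPartialDeriv, hev.fderiv_eq, vecPartialDeriv]
  rw [h0, hd]
  simp only [add_smul, Finset.sum_add_distrib]
  congr 1
  simp only [← h.sum_christoffel_smul hy m, Finset.smul_sum, Finset.sum_smul, smul_smul]
  rw [Finset.sum_comm]
  simp only [mul_comm]

theorem riemannTensor_eq_zero (h : IsPullbackOfConstant g e B F U) (hy : y ∈ U)
    (l k i j : Fin d) : riemannTensor g e l k i j y = 0 := by
  have h1 := h.sum_smul_eq_third_deriv hy i j k
  have h2 := h.sum_smul_eq_third_deriv hy j i k
  have hs := contDiffAt_vecPartialDeriv k (h.smooth y hy)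
  -- The third derivative is unchanged when `i` and `j` are exchanged, so the two expansions have
  -- equal coefficients.
  rw [vecPartialDeriv_comm j i hs, ← h1, eq_comm, ← sub_eq_zero, ← Finset.sum_sub_distrib] at h2
  simp only [← sub_smul] at h2
  have h3 := eq_zero_of_sum_smul_vecPartialDeriv (h.invertible y hy) h2 l
  rw [riemannTensor, Finset.sum_sub_distrib]
  linarith

end IsPullbackOfConstant
end Local
end ThreeCosymplectic

/-! ### Linear algebra: the three 2-forms determine the inner product. -/

namespace ThreeCosymplectic

/-- An almost contact metric 3-structure on a real vector space. -/
structure LinearThreeStructure (V : Type*) [AddCommGroup V] [Module ℝ V] where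
  /-- the inner product -/
  g : V →ₗ[ℝ] V →ₗ[ℝ] ℝ
  /-- the endomorphisms -/
  φ : Fin 3 → V →ₗ[ℝ] V
  /-- the Reeb vectors -/
  ξ : Fin 3 → V
  /-- the dual 1-forms -/
  η : Fin 3 → V →ₗ[ℝ] ℝ
  symm : ∀ X Y, g X Y = g Y X
  pos : ∀ X, X ≠ 0 → 0 < g X X
  φ_sq : ∀ α X, φ α (φ α X) = -X + η α X • ξ α
  η_ξ : ∀ α, η α (ξ α) = 1
  φ_φ : ∀ α β X, φ α (φ β X) - η β X • ξ α
    = ∑ γ, eps α β γ • φ γ X - (if α = β then (1 : ℝ) else 0) • X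
  φ_ξ : ∀ α β, φ α (ξ β) = ∑ γ, eps α β γ • ξ γ
  η_φ : ∀ α β X, η α (φ β X) = ∑ γ, eps α β γ * η γ X
  g_φ : ∀ α X Y, g (φ α X) (φ α Y) = g X Y - η α X * η α Y

namespace LinearThreeStructure

variable {V W : Type*} [AddCommGroup V] [Module ℝ V] [AddCommGroup W] [Module ℝ W]

/-- The fundamental 2-form `Φ_α(X, Y) = g(X, φ_α Y)`. -/
def Φ (S : LinearThreeStructure V) (α : Fin 3) (X Y : V) : ℝ := S.g X (S.φ α Y)

theorem eps_values : (∀ γ, eps 0 0 γ = 0) ∧ (∀ γ, eps 1 1 γ = 0) ∧ (∀ γ, eps 2 2 γ = 0) ∧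
    eps 0 1 0 = 0 ∧ eps 0 1 1 = 0 ∧ eps 0 1 2 = 1 ∧
    eps 1 0 0 = 0 ∧ eps 1 0 1 = 0 ∧ eps 1 0 2 = -1 ∧
    eps 0 2 0 = 0 ∧ eps 0 2 2 = 0 ∧ eps 0 2 1 = -1 ∧
    eps 2 0 0 = 0 ∧ eps 2 0 2 = 0 ∧ eps 2 0 1 = 1 ∧
    eps 1 2 1 = 0 ∧ eps 1 2 2 = 0 ∧ eps 1 2 0 = 1 ∧
    eps 2 1 1 = 0 ∧ eps 2 1 2 = 0 ∧ eps 2 1 0 = -1 := by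
  refine ⟨fun γ => ?_, fun γ => ?_, fun γ => ?_, ?_⟩
  · fin_cases γ <;> simp [eps, Matrix.det_fin_three]
  · fin_cases γ <;> simp [eps, Matrix.det_fin_three]
  · fin_cases γ <;> simp [eps, Matrix.det_fin_three]
  · simp [eps, Matrix.det_fin_three]

theorem φ_ξ_self (S : LinearThreeStructure V) (α : Fin 3) : S.φ α (S.ξ α) = 0 := by
  have h := eps_values
  rw [S.φ_ξ, Fin.sum_univ_three]
  fin_cases α <;> simp [h]

theorem η_φ_self (S : LinearThreeStructure V) (α : Fin 3) (X : V) : S.η α (S.φ α X) = 0 := by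
  have h := eps_values
  rw [S.η_φ, Fin.sum_univ_three]
  fin_cases α <;> simp [h]

theorem g_ξ (S : LinearThreeStructure V) (α : Fin 3) (X : V) : S.g X (S.ξ α) = S.η α X := by
  have h := S.g_φ α X (S.ξ α)
  rw [S.φ_ξ_self, map_zero, S.η_ξ] at h
  linarith

/-- Replace `Y` by `φ α Y` in `g_φ`: the terms in `η α` vanish because `η α ∘ φ α = 0`. -/
theorem g_φ_left (S : LinearThreeStructure V) (α : Fin 3) (X Y : V) :
    S.g (S.φ α X) Y = -S.g X (S.φ α Y) := by
  have h := S.g_φ α X (S.φ α Y)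
  rw [S.φ_sq, S.η_φ_self, map_add, map_smul, S.g_ξ, S.η_φ_self, map_neg] at h
  simp only [smul_zero, mul_zero] at h
  linarith

/-- Skewness moves `φ α` onto `ξ β`. For `α ≠ β` this recovers the third 1-form from `Φ α` and `ξ
β`. -/
theorem Φ_ξ_left (S : LinearThreeStructure V) (α β : Fin 3) (X : V) :
    S.Φ α (S.ξ β) X = -∑ γ, eps α β γ * S.η γ X := by
  rw [Φ, ← neg_eq_iff_eq_neg, ← S.g_φ_left, S.φ_ξ, S.symm, map_sum]
  simp [S.g_ξ]

/-- Testing against `X = φ α Z` gives `φ α Z = 0` by positivity, and `φ_sq` then identifies `Z`. -/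
theorem eq_smul_ξ_of_Φ_eq_zero (S : LinearThreeStructure V) (α : Fin 3) (Z : V)
    (h : ∀ X, S.Φ α X Z = 0) : Z = S.η α Z • S.ξ α := by
  have h0 : S.φ α Z = 0 := by
    by_contra hne
    exact (S.pos _ hne).ne' (h _)
  have h1 := S.φ_sq α Z
  rw [h0, map_zero] at h1
  rw [eq_comm, neg_add_eq_zero] at h1
  exact h1

theorem Φ_smul_left (S : LinearThreeStructure V) (α : Fin 3) (c : ℝ) (X Y : V) :
    S.Φ α (c • X) Y = c * S.Φ α X Y := by
  simp [Φ]

theorem Φ_sub_right (S : LinearThreeStructure V) (α : Fin 3) (X Y Z : V) :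
    S.Φ α X (Y - Z) = S.Φ α X Y - S.Φ α X Z := by
  simp [Φ]

/-- The horizontal part of a vector. -/
def hor (S : LinearThreeStructure V) (X : V) : V := X - ∑ γ, S.η γ X • S.ξ γ

theorem η_ξ_apply (S : LinearThreeStructure V) (α β : Fin 3) :
    S.η α (S.ξ β) = if α = β then 1 else 0 := by
  have h := eps_values
  -- By symmetry three off-diagonal values suffice; each follows from `η α ∘ φ α = 0`, since `φ α`
  -- sends one of the other two Reeb vectors to plus or minus the remaining one.
  have key : ∀ a b, S.η a (S.ξ b) = S.η b (S.ξ a) := fun a b => by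
    rw [← S.g_ξ, ← S.g_ξ, S.symm]
  have h1 : S.η 0 (S.ξ 1) = 0 := by
    have := S.η_φ_self 0 (S.ξ 2)
    rw [S.φ_ξ, Fin.sum_univ_three] at this
    simpa [h] using this
  have h2 : S.η 0 (S.ξ 2) = 0 := by
    have := S.η_φ_self 0 (S.ξ 1)
    rw [S.φ_ξ, Fin.sum_univ_three] at this
    simpa [h] using this
  have h3 : S.η 1 (S.ξ 2) = 0 := by
    have := S.η_φ_self 1 (S.ξ 0)
    rw [S.φ_ξ, Fin.sum_univ_three] at this
    simpa [h] using this
  fin_cases α <;> fin_cases β <;>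
    simp [S.η_ξ, h1, h2, h3, key 1 0, key 2 0, key 2 1]

theorem η_hor (S : LinearThreeStructure V) (α : Fin 3) (X : V) : S.η α (S.hor X) = 0 := by
  simp [hor, S.η_ξ_apply]

/-- On horizontal vectors `Φ₂ = -Φ₁(·, φ₃ ·)`. -/
theorem Φ_one_eq (S : LinearThreeStructure V) (X Z : V) (hX : ∀ γ, S.η γ X = 0) :
    S.Φ 1 Z X = -S.Φ 0 Z (S.φ 2 X) := by
  have h := eps_values
  have h1 := S.φ_φ 0 2 X
  rw [Fin.sum_univ_three] at h1
  simp [h, hX] at h1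
  rw [Φ, Φ, h1]
  simp

theorem g_eq_of_horizontal (S : LinearThreeStructure V) (X Z : V) (hX : ∀ γ, S.η γ X = 0) :
    S.g Z X = -S.Φ 2 Z (S.φ 2 X) := by
  rw [Φ, S.φ_sq, hX]
  simp

/-- The fundamental 2-forms determine the inner product. -/
theorem g_eq_of_Φ_eq (S : LinearThreeStructure V) (T : LinearThreeStructure W) (L : V ≃ₗ[ℝ] W)
    (hΦ : ∀ α X Y, T.Φ α (L X) (L Y) = S.Φ α X Y) (X Y : V) :
    T.g (L X) (L Y) = S.g X Y := by
  have he := eps_values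
  -- `L` respects the 2-forms, so it matches their kernels, which are the Reeb lines.
  obtain ⟨f, hf⟩ : ∃ f : Fin 3 → ℝ, ∀ α, T.ξ α = f α • L (S.ξ α) := by
    refine ⟨fun α => S.η α (L.symm (T.ξ α)), fun α => ?_⟩
    have h := S.eq_smul_ξ_of_Φ_eq_zero α (L.symm (T.ξ α)) fun X => by
      rw [← hΦ, L.apply_symm_apply, Φ, T.φ_ξ_self, map_zero]
    have h2 := congrArg L h
    rwa [L.apply_symm_apply, map_smul] at h2
  have hη : ∀ α β X, ∑ γ, eps α β γ * T.η γ (L X) = f β * ∑ γ, eps α β γ * S.η γ X := by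
    intro α β X
    have h := T.Φ_ξ_left α β (L X)
    rw [hf, Φ_smul_left, hΦ, S.Φ_ξ_left] at h
    linarith
  have hTξ : ∀ α β, f β * T.η α (L (S.ξ β)) = if α = β then 1 else 0 := by
    intro α β
    rw [← T.η_ξ_apply α β, hf β, map_smul, smul_eq_mul]
  have h01 := hη 0 1
  have h12 := hη 1 2
  have h20 := hη 2 0
  simp only [Fin.sum_univ_three, he, zero_mul, zero_add, add_zero, one_mul] at h01 h12 h20
  -- Each `T.η γ` is rescaled by the factor of another Reeb vector. Normalisation on `ξ γ` makes all
  -- pairwise products 1, so the three factors are equal with square 1.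
  have e01 : f 0 * f 2 = 1 := by
    have := hTξ 0 0
    rw [h12, S.η_ξ] at this
    simpa using this
  have e12 : f 1 * f 0 = 1 := by
    have := hTξ 1 1
    rw [h20, S.η_ξ] at this
    simpa using this
  have e20 : f 2 * f 1 = 1 := by
    have := hTξ 2 2
    rw [h01, S.η_ξ] at this
    simpa using this
  have f02 : f 0 = f 2 := by
    have : f 1 ≠ 0 := left_ne_zero_of_mul_eq_one e12
    apply mul_left_cancel₀ this
    linarith
  have f12 : f 1 = f 2 := by
    have : f 0 ≠ 0 := left_ne_zero_of_mul_eq_one e01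
    apply mul_left_cancel₀ this
    linarith
  rw [f02] at e01 h20
  rw [f12] at h01
  have hηf : ∀ α X, T.η α (L X) = f 2 * S.η α X := by
    intro α X
    fin_cases α
    exacts [h12 X, h20 X, h01 X]
  have hff : ∀ α, f α = f 2 := by
    intro α
    fin_cases α
    exacts [f02, f12, rfl]
  -- The same factor `f 2` multiplies both the Reeb vectors and the 1-forms, and cancels.
  have hgξ : ∀ X α, T.g (L X) (L (S.ξ α)) = S.η α X := by
    intro X α
    have h := T.g_ξ α (L X)
    rw [hf, hff, hηf, map_smul, smul_eq_mul] at h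
    exact mul_left_cancel₀ (left_ne_zero_of_mul_eq_one e01) h
  have hφ : ∀ X, (∀ γ, S.η γ X = 0) → T.φ 2 (L X) = L (S.φ 2 X) := by
    intro X hX
    have hTX : ∀ γ, T.η γ (L X) = 0 := fun γ => by rw [hηf, hX, mul_zero]
    rw [← sub_eq_zero]
    -- `Φ_one_eq` on both sides puts the difference in the kernel of `T.Φ 0`, so it is a multiple of
    -- `T.ξ 0`; the multiple is zero because both terms are killed by `T.η 0`.
    have h := T.eq_smul_ξ_of_Φ_eq_zero 0 (T.φ 2 (L X) - L (S.φ 2 X)) fun Z => by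
      obtain ⟨Z, rfl⟩ := L.surjective Z
      rw [Φ_sub_right, hΦ]
      have h1 := T.Φ_one_eq (L X) (L Z) hTX
      rw [hΦ, S.Φ_one_eq X Z hX] at h1
      linarith
    rw [h, map_sub, hηf, T.η_φ, S.η_φ]
    simp [hX, hTX]
  have hhor : ∀ X Z, (∀ γ, S.η γ X = 0) → T.g (L Z) (L X) = S.g Z X := by
    intro X Z hX
    rw [S.g_eq_of_horizontal X Z hX, T.g_eq_of_horizontal (L X) (L Z)
      (fun γ => by rw [hηf, hX, mul_zero]), hφ X hX, hΦ]
  have hY : Y = S.hor Y + ∑ γ, S.η γ Y • S.ξ γ := by simp [hor]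
  rw [hY, map_add, map_add, map_add, hhor _ _ (fun γ => S.η_hor γ Y)]
  simp [hgξ, S.g_ξ]

end LinearThreeStructure
end ThreeCosymplectic

/-! ### Chart differentials and transition maps. -/

namespace ThreeCosymplectic

section Chart
variable {d : ℕ} {M : Type*} [TopologicalSpace M] [ChartedSpace (EuclideanSpace ℝ (Fin d)) M]

theorem mdifferentiable_of_mem_maximalAtlas
    {e : OpenPartialHomeomorph M (EuclideanSpace ℝ (Fin d))}
    (he : e ∈ IsManifold.maximalAtlas (𝓡 d) ∞ M) : e.MDifferentiable (𝓡 d) (𝓡 d) :=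
  ⟨(contMDiffOn_of_mem_maximalAtlas he).mdifferentiableOn (by simp),
    (contMDiffOn_symm_of_mem_maximalAtlas he).mdifferentiableOn (by simp)⟩

theorem contDiffAt_transition {e e' : OpenPartialHomeomorph M (EuclideanSpace ℝ (Fin d))}
    (he : e ∈ IsManifold.maximalAtlas (𝓡 d) ∞ M) (he' : e' ∈ IsManifold.maximalAtlas (𝓡 d) ∞ M)
    {y : EuclideanSpace ℝ (Fin d)} (hy : y ∈ (e.symm ≫ₕ e').source) :
    ContDiffAt ℝ ∞ (e.symm ≫ₕ e') y := by
  simp only [mfld_simps] at hy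
  rw [← contMDiffAt_iff_contDiffAt]
  exact ContMDiffAt.comp (g := e') (f := e.symm) y
    ((contMDiffOn_of_mem_maximalAtlas he').contMDiffAt (e'.open_source.mem_nhds hy.2))
    ((contMDiffOn_symm_of_mem_maximalAtlas he).contMDiffAt (e.open_target.mem_nhds hy.1))

theorem isInvertible_fderiv_transition
    {e e' : OpenPartialHomeomorph M (EuclideanSpace ℝ (Fin d))}
    (he : e ∈ IsManifold.maximalAtlas (𝓡 d) ∞ M) (he' : e' ∈ IsManifold.maximalAtlas (𝓡 d) ∞ M)
    {y : EuclideanSpace ℝ (Fin d)} (hy : y ∈ (e.symm ≫ₕ e').source) :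
    (fderiv ℝ (e.symm ≫ₕ e') y).IsInvertible := by
  rw [← mfderiv_eq_fderiv]
  exact ⟨((mdifferentiable_of_mem_maximalAtlas he).symm.trans
    (mdifferentiable_of_mem_maximalAtlas he')).mfderiv hy, rfl⟩

/-- The differential of a chart, with values in the model space. -/
noncomputable def chartDeriv (e : OpenPartialHomeomorph M (EuclideanSpace ℝ (Fin d)))
    (he : e ∈ IsManifold.maximalAtlas (𝓡 d) ∞ M) {q : M} (hq : q ∈ e.source) :
    TangentSpace (𝓡 d) q ≃L[ℝ] EuclideanSpace ℝ (Fin d) :=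
  (mdifferentiable_of_mem_maximalAtlas he).mfderiv hq

theorem coordDiff_eq (e : OpenPartialHomeomorph M (EuclideanSpace ℝ (Fin d)))
    (he : e ∈ IsManifold.maximalAtlas (𝓡 d) ∞ M) {q : M} (hq : q ∈ e.source) (j : Fin d)
    (X : TangentSpace (𝓡 d) q) : coordDiff e j q X = chartDeriv e he hq X j := by
  have h1 := ((mdifferentiable_of_mem_maximalAtlas he).mdifferentiableAt hq).hasMFDerivAt
  have h2 : HasMFDerivAt (𝓡 d) 𝓘(ℝ, ℝ) (EuclideanSpace.proj (𝕜 := ℝ) j) (e q)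
      (EuclideanSpace.proj (𝕜 := ℝ) j : EuclideanSpace ℝ (Fin d) →L[ℝ] ℝ) :=
    (EuclideanSpace.proj (𝕜 := ℝ) j :
      EuclideanSpace ℝ (Fin d) →L[ℝ] ℝ).hasFDerivAt.hasMFDerivAt
  have h3 := (h2.comp q h1).mfderiv
  exact congrArg (fun A : TangentSpace (𝓡 d) q →L[ℝ] ℝ => A X) h3

theorem vecPartialDeriv_transition
    {e e' : OpenPartialHomeomorph M (EuclideanSpace ℝ (Fin d))}
    (he : e ∈ IsManifold.maximalAtlas (𝓡 d) ∞ M) (he' : e' ∈ IsManifold.maximalAtlas (𝓡 d) ∞ M)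
    {y : EuclideanSpace ℝ (Fin d)} (hy : y ∈ e.target) (hy' : e.symm y ∈ e'.source) (i : Fin d) :
    vecPartialDeriv i (e.symm ≫ₕ e') y = chartDeriv e' he' hy' (coordVec e i y) := by
  have h := mfderiv_comp y
    ((mdifferentiable_of_mem_maximalAtlas he').mdifferentiableAt hy')
    ((mdifferentiable_of_mem_maximalAtlas he).mdifferentiableAt_symm hy)
  rw [vecPartialDeriv, ← mfderiv_eq_fderiv]
  exact congrArg (fun A : EuclideanSpace ℝ (Fin d) →L[ℝ] EuclideanSpace ℝ (Fin d) =>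
    A (EuclideanSpace.single i 1)) h

end Chart

/-! ### Constant metric coefficients in Darboux charts, and flatness. -/

section Flat
variable {n : ℕ} {M : Type*} [TopologicalSpace M]
  [ChartedSpace (EuclideanSpace ℝ (Fin (4 * n + 3))) M] [IsManifold (𝓡 (4 * n + 3)) ∞ M]

/-- The structure on the tangent space at a point. -/
noncomputable def AlmostContactMetricThreeStructure.tangent
    (S : AlmostContactMetricThreeStructure n M) (p : M) :
    LinearThreeStructure (TangentSpace (𝓡 (4 * n + 3)) p) where
  g := LinearMap.mk₂ ℝ (fun X Y => S.g.inner p X Y) (by simp) (by simp) (by simp) (by simp)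
  φ α := (S.φ α p).toLinearMap
  ξ α := S.ξ α p
  η α := (S.η α p).toLinearMap
  symm X Y := S.g.symm p X Y
  pos X hX := S.g.pos p X hX
  φ_sq α X := S.φ_sq α p X
  η_ξ α := S.η_ξ α p
  φ_φ α β X := S.φ_φ α β p X
  φ_ξ α β := S.φ_ξ α β p
  η_φ α β X := S.η_φ α β p X
  g_φ α X Y := S.g_φ α p X Y

/-- Only the constancy of the coefficients matters later: `Ω` does not depend on the point `q`. -/
theorem IsDarbouxChart.exists_constant_forms {S : AlmostContactMetricThreeStructure n M} {σ : ℝ}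
    {e : OpenPartialHomeomorph M (EuclideanSpace ℝ (Fin (4 * n + 3)))} (h : IsDarbouxChart S σ e)
    (he : e ∈ IsManifold.maximalAtlas (𝓡 (4 * n + 3)) ∞ M) :
    ∃ Ω : Fin 3 → EuclideanSpace ℝ (Fin (4 * n + 3)) → EuclideanSpace ℝ (Fin (4 * n + 3)) → ℝ,
      ∀ (q : M) (hq : q ∈ e.source) (α : Fin 3) (X Y : TangentSpace (𝓡 (4 * n + 3)) q),
        S.Φ α q X Y = Ω α (chartDeriv e he hq X) (chartDeriv e he hq Y) := by
  let w (j k : Fin (4 * n + 3)) (v v' : EuclideanSpace ℝ (Fin (4 * n + 3))) : ℝ :=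
    (1 / 2) * (v j * v' k - v' j * v k)
  have hw : ∀ (q : M) (hq : q ∈ e.source) (j k) (X Y : TangentSpace (𝓡 (4 * n + 3)) q),
      coordWedge e j k q X Y = w j k (chartDeriv e he hq X) (chartDeriv e he hq Y) := by
    intro q hq j k X Y
    simp only [coordWedge, coordDiff_eq e he hq, w]
  refine ⟨![
    fun v v' => 2 * σ * ∑ i : Fin n, (w (ix i) (iy i) v v' + w (iu i) (iv i) v v')
      - 2 * w (iz 1) (iz 2) v v',
    fun v v' => 2 * σ * ∑ i : Fin n, (w (ix i) (iu i) v v' - w (iy i) (iv i) v v')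
      + 2 * w (iz 0) (iz 2) v v',
    fun v v' => 2 * σ * ∑ i : Fin n, (w (ix i) (iv i) v v' + w (iy i) (iu i) v v')
      - 2 * w (iz 0) (iz 1) v v'], fun q hq α X Y => ?_⟩
  obtain ⟨h0, h1, h2⟩ := h q hq X Y
  simp only [hw q hq] at h0 h1 h2
  fin_cases α
  exacts [h0, h1, h2]

/-- In a Darboux chart the metric has constant coefficients. -/
theorem IsDarbouxChart.metric_eq {S : AlmostContactMetricThreeStructure n M} {σ : ℝ}
    {e : OpenPartialHomeomorph M (EuclideanSpace ℝ (Fin (4 * n + 3)))} (h : IsDarbouxChart S σ e)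
    (he : e ∈ IsManifold.maximalAtlas (𝓡 (4 * n + 3)) ∞ M) {p q : M} (hp : p ∈ e.source)
    (hq : q ∈ e.source) (X Y : TangentSpace (𝓡 (4 * n + 3)) q) :
    S.g.inner q X Y = S.g.inner p ((chartDeriv e he hp).symm (chartDeriv e he hq X))
      ((chartDeriv e he hp).symm (chartDeriv e he hq Y)) := by
  obtain ⟨Ω, hΩ⟩ := h.exists_constant_forms he
  -- The comparison map from the tangent space at `q` to that at `p` identifies vectors with equal
  -- coordinates, so it preserves the 2-forms.
  refine ((S.tangent q).g_eq_of_Φ_eq (S.tangent p)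
    ((chartDeriv e he hq).trans (chartDeriv e he hp).symm).toLinearEquiv ?_ X Y).symm
  intro α X Y
  refine (hΩ p hp α _ _).trans (Eq.trans ?_ (hΩ q hq α X Y).symm)
  simp

/-- `B` is the inner product at the single point `p`, carried to the model space by the chart. -/
theorem IsDarbouxChart.exists_bilin {S : AlmostContactMetricThreeStructure n M} {σ : ℝ}
    {e : OpenPartialHomeomorph M (EuclideanSpace ℝ (Fin (4 * n + 3)))} (h : IsDarbouxChart S σ e)
    (he : e ∈ IsManifold.maximalAtlas (𝓡 (4 * n + 3)) ∞ M) {p : M} (hp : p ∈ e.source) :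
    ∃ B : EuclideanSpace ℝ (Fin (4 * n + 3)) →L[ℝ] EuclideanSpace ℝ (Fin (4 * n + 3)) →L[ℝ] ℝ,
      (∀ v w, B v w = B w v) ∧ (∀ v, B v v = 0 → v = 0) ∧
      ∀ (q : M) (hq : q ∈ e.source) (X Y : TangentSpace (𝓡 (4 * n + 3)) q),
        S.g.inner q X Y = B (chartDeriv e he hq X) (chartDeriv e he hq Y) := by
  let L := (chartDeriv e he hp).symm.toLinearEquiv.toLinearMap
  obtain ⟨B, hB⟩ : ∃ B : EuclideanSpace ℝ (Fin (4 * n + 3)) →L[ℝ]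
      EuclideanSpace ℝ (Fin (4 * n + 3)) →L[ℝ] ℝ, ∀ v w, B v w = (S.tangent p).g (L v) (L w) :=
    ⟨LinearMap.toContinuousBilinearMap ((S.tangent p).g.compl₁₂ L L), fun _ _ => rfl⟩
  refine ⟨B, fun v w => ?_, fun v hv => ?_, fun q hq X Y => ?_⟩
  · rw [hB, hB, (S.tangent p).symm]
  · rw [hB] at hv
    by_contra hne
    refine ((S.tangent p).pos (L v) fun h0 => hne ?_).ne' hv
    exact (chartDeriv e he hp).symm.toLinearEquiv.map_eq_zero_iff.mp h0
  · rw [hB]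
    exact h.metric_eq he hp hq X Y

theorem isFlat_of_forall_exists_isDarbouxChart {S : AlmostContactMetricThreeStructure n M}
    (hD : ∀ p : M, ∃ e ∈ IsManifold.maximalAtlas (𝓡 (4 * n + 3)) ∞ M, p ∈ e.source ∧
      ∃ σ : ℝ, IsDarbouxChart S σ e) : IsFlat S.g := by
  intro e he p hp l k i j
  obtain ⟨e', he', hp', σ, h⟩ := hD p
  obtain ⟨B, hB⟩ := h.exists_bilin he' hp'
  -- Here `e` is the arbitrary chart in which curvature is computed and `e'` the Darboux chart
  -- around `p`; `F` is the change of coordinates from `e` to `e'`.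
  have hpull : IsPullbackOfConstant S.g e B (e.symm ≫ₕ e') (e.symm ≫ₕ e').source :=
    { isOpen := (e.symm ≫ₕ e').open_source
      symm := hB.1
      definite := hB.2.1
      smooth := fun y hy => contDiffAt_transition he he' hy
      invertible := fun y hy => isInvertible_fderiv_transition he he' hy
      metric := fun y hy i j => by
        have hy' : y ∈ e.target ∧ e.symm y ∈ e'.source := by simpa only [mfld_simps] using hy
        rw [vecPartialDeriv_transition he he' hy'.1 hy'.2,
          vecPartialDeriv_transition he he' hy'.1 hy'.2, ← hB.2.2]
        rfl }
  exact hpull.riemannTensor_eq_zero (by simp [hp, hp']) l k i j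

end Flat
end ThreeCosymplectic

theorem mainTheorem4 (n : ℕ) {M : Type*} [TopologicalSpace M]
    [ChartedSpace (EuclideanSpace ℝ (Fin (4 * n + 3))) M]
    [IsManifold (𝓡 (4 * n + 3)) ∞ M]
    (S : ThreeCosymplectic.AlmostContactMetricThreeStructure n M) (hS : S.IsThreeCosymplectic)
    (hD : ∀ p : M, ∃ e ∈ IsManifold.maximalAtlas (𝓡 (4 * n + 3)) ∞ M, p ∈ e.source ∧
      ∃ σ : ℝ, (σ = 1 ∨ σ = -1) ∧
        ThreeCosymplectic.IsDarbouxChart S σ e) :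
    ThreeCosymplectic.IsFlat S.g := by
  refine ThreeCosymplectic.isFlat_of_forall_exists_isDarbouxChart fun p => ?_
  obtain ⟨e, he, hp, σ, -, h⟩ := hD p
  exact ⟨e, he, hp, σ, h⟩
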